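/- Let $\mathfrak{o}$ be a complete discrete valuation ring with finite residue field of odd characteristic, with maximal ideal $\mathfrak{p}$ and a fixed uniformizer $\pi$. Let $\mathfrak{O}$ be an unramified quadratic extension of $\mathfrak{o}$ (again a discrete valuation ring), with maximal ideal $\mathfrak{P}$, and let $x\mapsto x^\circ$ be the non-trivial automorphism of $\mathfrak{O}$ over $\mathfrak{o}$. For an integer $k\ge 0$ put $\mathfrak{o}_k=\mathfrak{o}/\mathfrak{p}^k$ and $\mathfrak{O}_k=\mathfrak{O}/\mathfrak{P}^k$; elements of $\mathfrak{o}_k$ are also regarded as elements of $\mathfrak{O}_k$, and $x\mapsto x^\circ$ also denotes the induced map on $\mathfrak{O}_k$. Let $\ell\ge 1$. For $A=(a_{i,j})\in M_2(\mathfrak{O}_\ell)$ put $A^\star=W(a_{j,i}^\circ)W^{-1}$ with $W=\begin{pmatrix}0&1\\1&0\end{pmatrix}$, and let $$\mathrm{GU}_2(\mathfrak{o}_\ell)=\{A\in \mathrm{GL}_2(\mathfrak{O}_\ell)\mid A^\star A=\mathrm{I}_2\}.$$ An element of a group is called real if it is conjugate to its inverse in that group. **Theorem.** Let $A\in\mathrm{GU}_2(\mathfrak{o}_\ell)$.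 The following statements are equivalent: 1. $A$ is real in $\mathrm{GU}_2(\mathfrak{o}_\ell)$. 2. $\det(A)\in\{\pm1\}$ and $\mathrm{tr}(A)=\mathrm{tr}(A^{-1})$. 3. $A$ is conjugate in $\mathrm{GU}_2(\mathfrak{o}_\ell)$ to an element of $\mathrm{GU}_2(\mathfrak{o}_\ell)$ of one of the following forms: - (a) $\begin{pmatrix}x&0\\0&x\end{pmatrix}$, where $x\in\{\pm1\}$; - (b) $\begin{pmatrix}x&0\\0&x^{-1}\end{pmatrix}$, where $x\in\mathfrak{o}_\ell^\times$ and $x^2\ne1$; - (c) $\begin{pmatrix}0&1\\1&0\end{pmatrix}$, or $\begin{pmatrix}x&y\\y&x\end{pmatrix}$, where $x,y\in\mathfrak{O}_\ell$, $y\neq0$, $xx^\circ+yy^\circ=1$, $xy^\circ+x^\circ y=0$ and $x^2-y^2=1$; - (d) $\begin{pmatrix}x&\pi^{i+1}\beta y\\ \pi^i y&x\end{pmatrix}$, where $0\le i\le\ell-1$, $\beta\in\mathfrak{o}_{\ell-i-1}$, $x\in\mathfrak{o}_\ell^\times$, $y\in\mathfrak{O}_\ell^\times$, $x^2+\pi^{2i+1}\beta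 yy^\circ=1=x^2-\pi^{2i+1}\beta y^2$ and $\pi^i(xy^\circ+x^\circ y)=0$. Here $\pi^{i+1}\beta$ and $\pi^{2i+1}\beta=\pi^i\cdot\pi^{i+1}\beta$ are elements of $\mathfrak{o}_\ell$; they are well defined because multiplication by $\pi^{i+1}$ induces a map $\mathfrak{o}_{\ell-i-1}\to\mathfrak{o}_\ell$. -/

import Mathlib

open IsLocalRing Matrix

namespace UnitaryReal

/-- An element of a group is real if it is conjugate, in the group, to its inverse. -/
def IsRealElement {G : Type*} [Group G] (g : G) : Prop := IsConj g g⁻¹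

section QuotientRing

variable (R : Type*) [CommRing R] [IsLocalRing R]

/-- `R / 𝔪 ^ ℓ` for a local ring `R` with maximal ideal `𝔪`.
For `R = 𝔬` this is `𝔬_ℓ`, for `R = 𝔒` it is `𝔒_ℓ`. -/
abbrev QuotPow (ℓ : ℕ) : Type _ := R ⧸ (maximalIdeal R) ^ ℓ

variable {R}

theorem mul_pow_mem_maximalIdeal_pow {ϖ : R} (hϖ : Irreducible ϖ) (ℓ k : ℕ) :
    (maximalIdeal R) ^ (ℓ - k) ≤
      Submodule.comap (LinearMap.mulLeft R (ϖ ^ k)) ((maximalIdeal R) ^ ℓ) := by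
  intro x hx
  have h1 : ϖ ∈ maximalIdeal R := (mem_maximalIdeal ϖ).2 hϖ.not_isUnit
  have h2 : ϖ ^ k * x ∈ (maximalIdeal R) ^ (k + (ℓ - k)) := by
    rw [pow_add]
    exact Ideal.mul_mem_mul (Ideal.pow_mem_pow h1 k) hx
  have h3 : ℓ ≤ k + (ℓ - k) := by omega
  exact Ideal.pow_le_pow_right h3 h2

/-- The well-defined map `R / 𝔪 ^ (ℓ - k) → R / 𝔪 ^ ℓ`, `β ↦ ϖ ^ k β`, induced by multiplication
by `ϖ ^ k` on `R`. -/
def mulPow {ϖ : R} (hϖ : Irreducible ϖ) (ℓ k : ℕ) : QuotPow R (ℓ - k) →ₗ[R] QuotPow R ℓ :=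
  Submodule.mapQ _ _ (LinearMap.mulLeft R (ϖ ^ k)) (mul_pow_mem_maximalIdeal_pow hϖ ℓ k)

end QuotientRing

section Extension

variable (𝔬 𝔒 : Type*) [CommRing 𝔬] [IsLocalRing 𝔬] [CommRing 𝔒] [IsLocalRing 𝔒]
  [Algebra 𝔬 𝔒] [Algebra.IsQuadraticExtension 𝔬 𝔒]

theorem maximalIdeal_pow_le_comap (ℓ : ℕ) :
    (maximalIdeal 𝔬) ^ ℓ ≤ ((maximalIdeal 𝔒) ^ ℓ).comap (algebraMap 𝔬 𝔒) := by
  rw [← Ideal.map_le_iff_le_comap, Ideal.map_pow]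
  exact Ideal.pow_right_mono (((local_hom_TFAE (algebraMap 𝔬 𝔒)).out 0 2 :
    IsLocalHom (algebraMap 𝔬 𝔒) ↔ _).1 inferInstance) ℓ

/-- The natural map `𝔬_ℓ → 𝔒_ℓ`. -/
def incl (ℓ : ℕ) : QuotPow 𝔬 ℓ →+* QuotPow 𝔒 ℓ :=
  Ideal.quotientMap _ (algebraMap 𝔬 𝔒) (maximalIdeal_pow_le_comap 𝔬 𝔒 ℓ)

end Extension

section Unitary

variable {𝔬 𝔒 : Type*} [CommRing 𝔬] [CommRing 𝔒] [IsLocalRing 𝔒] [Algebra 𝔬 𝔒]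
  (σ : 𝔒 ≃ₐ[𝔬] 𝔒)

theorem maximalIdeal_pow_le_comap_conj (ℓ : ℕ) :
    (maximalIdeal 𝔒) ^ ℓ ≤ ((maximalIdeal 𝔒) ^ ℓ).comap (σ : 𝔒 →+* 𝔒) := by
  rw [← Ideal.map_le_iff_le_comap, Ideal.map_pow]
  refine Ideal.pow_right_mono (Ideal.map_le_iff_le_comap.2 fun x hx => ?_) ℓ
  rw [mem_maximalIdeal, mem_nonunits_iff] at hx
  rw [Ideal.mem_comap, mem_maximalIdeal, mem_nonunits_iff]
  intro h
  have h2 := h.map (σ.symm : 𝔒 →+* 𝔒)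
  simp at h2
  exact hx h2

/-- The map `x ↦ x°` on `𝔒_ℓ` induced by the automorphism `σ` of `𝔒` over `𝔬`. -/
def conj (ℓ : ℕ) : QuotPow 𝔒 ℓ →+* QuotPow 𝔒 ℓ :=
  Ideal.quotientMap _ (σ : 𝔒 →+* 𝔒) (maximalIdeal_pow_le_comap_conj σ ℓ)

theorem conj_mk (ℓ : ℕ) (x : 𝔒) :
    conj σ ℓ (Ideal.Quotient.mk _ x) = Ideal.Quotient.mk _ (σ x) := rfl

/-- The permutation matrix `W = (0 1; 1 0)`. -/
def weyl (S : Type*) [CommRing S] : Matrix (Fin 2) (Fin 2) S := !![0, 1; 1, 0]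

/-- `A^⋆ = W (a_{j,i}°) W⁻¹` for `A = (a_{i,j})`. -/
noncomputable def starOp (ℓ : ℕ) (A : Matrix (Fin 2) (Fin 2) (QuotPow 𝔒 ℓ)) :
    Matrix (Fin 2) (Fin 2) (QuotPow 𝔒 ℓ) :=
  weyl (QuotPow 𝔒 ℓ) * (A.map (conj σ ℓ))ᵀ * (weyl (QuotPow 𝔒 ℓ))⁻¹

theorem weyl_mul_weyl (S : Type*) [CommRing S] : weyl S * weyl S = 1 := by
  ext i j; fin_cases i <;> fin_cases j <;> simp [weyl]

theorem weyl_inv (S : Type*) [CommRing S] : (weyl S)⁻¹ = weyl S :=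
  Matrix.inv_eq_right_inv (weyl_mul_weyl S)

theorem starOp_one (ℓ : ℕ) : starOp σ ℓ 1 = 1 := by
  simp [starOp, weyl_inv, weyl_mul_weyl, Matrix.map_one]

theorem starOp_mul (ℓ : ℕ) (A B : Matrix (Fin 2) (Fin 2) (QuotPow 𝔒 ℓ)) :
    starOp σ ℓ (A * B) = starOp σ ℓ B * starOp σ ℓ A := by
  have h := weyl_mul_weyl (QuotPow 𝔒 ℓ)
  simp only [starOp, weyl_inv, Matrix.map_mul, Matrix.transpose_mul]
  simp only [Matrix.mul_assoc]
  rw [← Matrix.mul_assoc (weyl _) (weyl _), h, Matrix.one_mul]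

/-- `GU₂(𝔬_ℓ) = {A ∈ GL₂(𝔒_ℓ) | A^⋆ A = I}`. -/
noncomputable def GU2 (ℓ : ℕ) : Subgroup (GL (Fin 2) (QuotPow 𝔒 ℓ)) where
  carrier := {A | starOp σ ℓ (A : Matrix (Fin 2) (Fin 2) (QuotPow 𝔒 ℓ)) *
    (A : Matrix (Fin 2) (Fin 2) (QuotPow 𝔒 ℓ)) = 1}
  one_mem' := by simp [starOp_one]
  mul_mem' := by
    intro A B hA hB
    simp only [Set.mem_ofPred_eq, Units.val_mul, starOp_mul] at *
    rw [Matrix.mul_assoc, ← Matrix.mul_assoc _ A.val, hA, Matrix.one_mul, hB]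
  inv_mem' := by
    intro A hA
    simp only [Set.mem_ofPred_eq] at *
    have h1 : starOp σ ℓ A.val = (A⁻¹).val := by
      rw [← Matrix.mul_one (starOp σ ℓ A.val), ← Units.mul_inv A, ← Matrix.mul_assoc, hA,
        Matrix.one_mul]
    calc starOp σ ℓ (A⁻¹).val * (A⁻¹).val
        = starOp σ ℓ (A⁻¹).val * starOp σ ℓ A.val := by rw [h1]
      _ = 1 := by rw [← starOp_mul, Units.mul_inv, starOp_one]

/-- The underlying matrix of an element of `GU₂(𝔬_ℓ)`. -/
def mat {σ : 𝔒 ≃ₐ[𝔬] 𝔒} {ℓ : ℕ} (A : GU2 σ ℓ) : Matrix (Fin 2) (Fin 2) (QuotPow 𝔒 ℓ) :=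
  (A : GL (Fin 2) (QuotPow 𝔒 ℓ)).val

end Unitary

section Forms

variable {𝔬 𝔒 : Type*} [CommRing 𝔬] [IsLocalRing 𝔬] [CommRing 𝔒] [IsLocalRing 𝔒]
  [Algebra 𝔬 𝔒] [Algebra.IsQuadraticExtension 𝔬 𝔒] {σ : 𝔒 ≃ₐ[𝔬] 𝔒} {ℓ : ℕ}

/-- Family (a): `(x 0; 0 x)` with `x ∈ {1, -1}`. -/
def FormA (B : GU2 σ ℓ) : Prop :=
  ∃ x : QuotPow 𝔒 ℓ, (x = 1 ∨ x = -1) ∧ mat B = !![x, 0; 0, x]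

/-- Family (b): `(x 0; 0 x⁻¹)` with `x` a unit of `𝔬_ℓ` and `x² ≠ 1`. -/
def FormB (B : GU2 σ ℓ) : Prop :=
  ∃ x : (QuotPow 𝔬 ℓ)ˣ, x ^ 2 ≠ 1 ∧
    mat B = !![incl 𝔬 𝔒 ℓ x.val, 0; 0, incl 𝔬 𝔒 ℓ (x⁻¹).val]

/-- Family (c): `(0 1; 1 0)`, or `(x y; y x)` with `x, y ∈ 𝔒_ℓ`, `y ≠ 0`, `xx° + yy° = 1`,
`xy° + x°y = 0` and `x² - y² = 1`. -/
def FormC (B : GU2 σ ℓ) : Prop :=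
  mat B = !![0, 1; 1, 0] ∨
  ∃ x y : QuotPow 𝔒 ℓ, y ≠ 0 ∧
    x * conj σ ℓ x + y * conj σ ℓ y = 1 ∧
    x * conj σ ℓ y + conj σ ℓ x * y = 0 ∧
    x ^ 2 - y ^ 2 = 1 ∧
    mat B = !![x, y; y, x]

/-- Family (d): `(x πⁱ⁺¹βy; πⁱy x)` with `0 ≤ i ≤ ℓ - 1`, `β ∈ 𝔬_{ℓ-i-1}`, `x` a unit of `𝔬_ℓ`,
`y` a unit of `𝔒_ℓ`, `x² + π²ⁱ⁺¹βyy° = 1 = x² - π²ⁱ⁺¹βy²` and `πⁱ(xy° + x°y) = 0`.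
In the code `b` is `πⁱ⁺¹β` and `p` is `πⁱ`, both in `𝔒_ℓ`, so that `π²ⁱ⁺¹β` is `p * b`. -/
def FormD {ϖ : 𝔬} (hϖ : Irreducible ϖ) (B : GU2 σ ℓ) : Prop :=
  ∃ i : ℕ, i < ℓ ∧ ∃ β : QuotPow 𝔬 (ℓ - (i + 1)), ∃ x₀ : (QuotPow 𝔬 ℓ)ˣ,
    ∃ y₀ : (QuotPow 𝔒 ℓ)ˣ,
    let p : QuotPow 𝔒 ℓ := incl 𝔬 𝔒 ℓ (Ideal.Quotient.mk _ (ϖ ^ i))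
    let b : QuotPow 𝔒 ℓ := incl 𝔬 𝔒 ℓ (mulPow hϖ ℓ (i + 1) β)
    let x : QuotPow 𝔒 ℓ := incl 𝔬 𝔒 ℓ x₀.val
    let y : QuotPow 𝔒 ℓ := y₀.val
    x ^ 2 + p * b * (y * conj σ ℓ y) = 1 ∧
    x ^ 2 - p * b * y ^ 2 = 1 ∧
    p * (x * conj σ ℓ y + conj σ ℓ x * y) = 0 ∧
    mat B = !![x, b * y; p * y, x]

end Forms

end UnitaryReal

/-! Conditions 1 ⇒ 2 and 3 ⇒ 1 are short. Reality forces det² = 1, and 2 is a unit in a local ring.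
Conversely, `W` inverts diag(x, x⁻¹), and diag(w, -w) with ww° = -1 inverts a determinant-one matrix
with equal diagonal entries.

For 2 ⇒ 3, write 𝔒 = 𝔬 ⊕ 𝔬ε with ε° = -ε and ε² = u a unit that is a non-square mod 𝔭. Comparing A⁻¹
= A^⋆ with the adjugate puts each entry of A in the image of 𝔬 or of 𝔬ε. If det A = 1, then A = τ +
πⁱX with X = (m, bε; cε, -m), where one of m, b, c is a unit, or else A is scalar. If det A = -1,
the trace condition gives A = εX with X of the same shape.

The key lemma (`exists_intertwine_antidiagonal`) conjugates X unitarily to (0, kε; ρε, 0) for any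
unit ρ with ρuk = δ, where δ = m² + ubc. A suitable cyclic vector for X exists because X is
primitive and every unit of 𝔬 is a norm. For det A = 1 the class of δ selects the family: a unit
square gives a diagonal matrix, (b) or (a); a unit in the class of u gives a symmetric one, (c) or
(a); a non-unit gives (d). For det A = -1 the result is `W`. -/

namespace UnitaryReal

/-! ### Units and squares modulo the maximal ideal -/

section Residue

variable {R : Type*} [CommRing R] [IsLocalRing R]

theorem isUnit_two_of_odd_ringChar (hodd : Odd (ringChar (ResidueField R))) :
    IsUnit (2 : R) := by
  by_contra h
  have h2 : residue R 2 = 0 := (residue_eq_zero_iff _).2 h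
  rw [map_ofNat] at h2
  refine Ring.two_ne_zero (R := ResidueField R) (fun h3 => ?_) h2
  rw [h3] at hodd
  exact absurd hodd (by decide)

/-- Hensel's lemma for X² - c: the derivative 2a at an approximate root a is a unit. -/
theorem isSquare_of_isSquare_residue [IsAdicComplete (maximalIdeal R) R]
    (h2 : IsUnit (2 : R)) {c : R} (hc : IsUnit c) (h : IsSquare (residue R c)) :
    IsSquare c := by
  obtain ⟨r, hr⟩ := h
  obtain ⟨a, rfl⟩ := residue_surjective r
  have ha : IsUnit a := by
    have h1 : IsUnit (residue R c) := hc.map _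
    rw [hr] at h1
    exact (isUnit_map_iff (residue R) a).1 (isUnit_of_mul_isUnit_left h1)
  have hm : (Polynomial.X ^ 2 - Polynomial.C c).Monic :=
    Polynomial.monic_X_pow_sub_C c two_ne_zero
  obtain ⟨w, hw, -⟩ := HenselianRing.is_henselian (I := maximalIdeal R) _ hm a
    (by
      rw [← residue_eq_zero_iff]
      simp [hr, sq])
    (by
      simp only [Polynomial.derivative_sub, Polynomial.derivative_X_pow,
        Polynomial.derivative_C, sub_zero]
      refine IsUnit.map _ ?_
      simpa using h2.mul ha)
  refine ⟨w, ?_⟩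
  simp only [Polynomial.IsRoot.def, Polynomial.eval_sub, Polynomial.eval_pow,
    Polynomial.eval_X, Polynomial.eval_C] at hw
  linear_combination -hw

end Residue

/-! ### Skew generators of the quadratic extension -/

section SkewGenerator

variable {𝔬 𝔒 : Type*} [CommRing 𝔬] [IsLocalRing 𝔬] [CommRing 𝔒] [Algebra 𝔬 𝔒]

/-- `ε` generates `𝔒` over `𝔬`, is negated by `σ`, and its square `u` is a non-square modulo the
maximal ideal. -/
structure IsSkewGenerator (σ : 𝔒 ≃ₐ[𝔬] 𝔒) (ε : 𝔒) (u : 𝔬) : Prop where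
  sq_eq : ε ^ 2 = algebraMap 𝔬 𝔒 u
  conj_eq : σ ε = -ε
  exists_eq : ∀ z : 𝔒, ∃ a b : 𝔬, z = algebraMap 𝔬 𝔒 a + algebraMap 𝔬 𝔒 b * ε
  not_isSquare : ¬ IsSquare (residue 𝔬 u)

namespace IsSkewGenerator

variable {σ : 𝔒 ≃ₐ[𝔬] 𝔒} {ε : 𝔒} {u : 𝔬}

theorem isUnit_sq (h : IsSkewGenerator σ ε u) : IsUnit u := by
  by_contra hu
  refine h.not_isSquare ?_
  rw [(residue_eq_zero_iff u).2 hu]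
  exact IsSquare.zero

theorem isUnit (h : IsSkewGenerator σ ε u) : IsUnit ε := by
  have h1 : IsUnit (ε ^ 2) := h.sq_eq ▸ h.isUnit_sq.map (algebraMap 𝔬 𝔒)
  exact (isUnit_pow_iff two_ne_zero).1 h1

end IsSkewGenerator

end SkewGenerator

section Existence

variable {𝔬 𝔒 : Type*} [CommRing 𝔬] [IsLocalRing 𝔬] [CommRing 𝔒] [IsLocalRing 𝔒]
  [Algebra 𝔬 𝔒] [Algebra.IsQuadraticExtension 𝔬 𝔒]

/-- A quadratic extension of a local ring by a local ring is generated by one element. -/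
theorem exists_generator_of_isQuadraticExtension : ∃ θ : 𝔒, ∀ z : 𝔒, ∃ a b : 𝔬,
    z = algebraMap 𝔬 𝔒 a + algebraMap 𝔬 𝔒 b * θ := by
  have key : ∀ (p q : 𝔬) (x y : 𝔒), IsUnit (algebraMap 𝔬 𝔒 p * x) →
      1 = algebraMap 𝔬 𝔒 p * x + algebraMap 𝔬 𝔒 q * y →
      (∀ z : 𝔒, ∃ a b : 𝔬, z = algebraMap 𝔬 𝔒 a * x + algebraMap 𝔬 𝔒 b * y) →
      ∃ θ : 𝔒, ∀ z : 𝔒, ∃ a b : 𝔬, z = algebraMap 𝔬 𝔒 a + algebraMap 𝔬 𝔒 b * θ := by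
    intro p q x y hp h1 hz
    have hp' : IsUnit p := isUnit_of_map_unit (algebraMap 𝔬 𝔒) p (isUnit_of_mul_isUnit_left hp)
    obtain ⟨p', hp'⟩ := hp'.exists_right_inv
    have e : algebraMap 𝔬 𝔒 p * algebraMap 𝔬 𝔒 p' = 1 := by rw [← map_mul, hp', map_one]
    refine ⟨y, fun z => ?_⟩
    obtain ⟨a, b, rfl⟩ := hz z
    refine ⟨a * p', b - a * p' * q, ?_⟩
    simp only [map_mul, map_sub]
    linear_combination (-algebraMap 𝔬 𝔒 a * algebraMap 𝔬 𝔒 p') * h1 -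
      algebraMap 𝔬 𝔒 a * x * e
  have : Module.Finite 𝔬 𝔒 := inferInstance
  let B := Module.finBasisOfFinrankEq 𝔬 𝔒 (Algebra.IsQuadraticExtension.finrank_eq_two 𝔬 𝔒)
  have hB : ∀ z : 𝔒, ∃ a b : 𝔬, z = algebraMap 𝔬 𝔒 a * B 0 + algebraMap 𝔬 𝔒 b * B 1 := by
    intro z
    refine ⟨B.repr z 0, B.repr z 1, ?_⟩
    conv_lhs => rw [← B.sum_repr z, Fin.sum_univ_two]
    simp [Algebra.smul_def]
  obtain ⟨p, q, h1⟩ := hB 1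
  -- Since 𝔒 is local, one summand of 1 = pB₀ + qB₁ is a unit, and that basis vector can be
  -- exchanged for 1.
  rcases IsLocalRing.isUnit_or_isUnit_of_isUnit_add (h1 ▸ isUnit_one) with h | h
  · exact key p q _ _ h h1 hB
  · refine key q p (B 1) (B 0) h (h1.trans (add_comm _ _)) fun z => ?_
    obtain ⟨a, b, hz⟩ := hB z
    exact ⟨b, a, hz.trans (add_comm _ _)⟩

theorem exists_isSkewGenerator [IsDomain 𝔒] [Algebra.FormallyUnramified 𝔬 𝔒]
    (h2 : IsUnit (2 : 𝔬)) {ϖ : 𝔬} (hϖ : maximalIdeal 𝔬 = Ideal.span {ϖ})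
    (σ : 𝔒 ≃ₐ[𝔬] 𝔒) (hσ : σ ≠ AlgEquiv.refl) :
    ∃ (ε : 𝔒) (u : 𝔬), IsSkewGenerator σ ε u := by
  obtain ⟨θ, hθ⟩ := exists_generator_of_isQuadraticExtension (𝔬 := 𝔬) (𝔒 := 𝔒)
  obtain ⟨i2, hi2⟩ := h2.exists_right_inv
  have hi2' : (2 : 𝔒) * algebraMap 𝔬 𝔒 i2 = 1 := by
    rw [← map_ofNat (algebraMap 𝔬 𝔒), ← map_mul, hi2, map_one]
  have htwo : (2 : 𝔒) ≠ 0 := left_ne_zero_of_mul_eq_one hi2'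
  obtain ⟨n, t, ht⟩ := hθ (θ ^ 2)
  -- Completing the square in θ² = n + tθ.
  set ε : 𝔒 := θ - algebraMap 𝔬 𝔒 (t * i2) with hε
  have hsq : ε ^ 2 = algebraMap 𝔬 𝔒 (n + (t * i2) ^ 2) := by
    simp only [hε, map_add, map_mul, map_pow]
    linear_combination ht - θ * algebraMap 𝔬 𝔒 t * hi2'
  have hdec : ∀ z : 𝔒, ∃ a b : 𝔬, z = algebraMap 𝔬 𝔒 a + algebraMap 𝔬 𝔒 b * ε := by
    intro z
    obtain ⟨a, b, rfl⟩ := hθ z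
    refine ⟨a + b * (t * i2), b, ?_⟩
    simp only [hε, map_add, map_mul]
    ring
  have hconj : σ ε = -ε := by
    have h3 : (σ ε) ^ 2 = ε ^ 2 := by rw [← map_pow, hsq, AlgEquiv.commutes]
    rcases sq_eq_sq_iff_eq_or_eq_neg.1 h3 with h | h
    · exfalso
      refine hσ (AlgEquiv.ext fun z => ?_)
      obtain ⟨a, b, rfl⟩ := hdec z
      simp [h]
    · exact h
  have hε0 : ε ≠ 0 := by
    intro h0
    refine hσ (AlgEquiv.ext fun z => ?_)
    obtain ⟨a, b, rfl⟩ := hdec z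
    simp [h0]
  refine ⟨ε, _, hsq, hconj, hdec, ?_⟩
  rintro ⟨r, hr⟩
  obtain ⟨r, rfl⟩ := residue_surjective r
  have hmax : maximalIdeal 𝔒 = Ideal.span {algebraMap 𝔬 𝔒 ϖ} := by
    rw [← Algebra.FormallyUnramified.map_maximalIdeal (R := 𝔬), hϖ, Ideal.map_span,
      Set.image_singleton]
  have hmem : n + (t * i2) ^ 2 - r * r ∈ maximalIdeal 𝔬 := by
    rw [← residue_eq_zero_iff, map_sub, map_mul, hr, sub_self]
  have hmem' : (ε - algebraMap 𝔬 𝔒 r) * (ε + algebraMap 𝔬 𝔒 r) ∈ maximalIdeal 𝔒 := by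
    have h3 := Ideal.mem_map_of_mem (algebraMap 𝔬 𝔒) hmem
    rw [Algebra.FormallyUnramified.map_maximalIdeal] at h3
    convert h3 using 1
    rw [map_sub, ← hsq, map_mul]
    ring
  -- Unramifiedness makes ϖ generate 𝔓. If ε + s = ϖ(a + bε), applying σ and subtracting gives 2ε =
  -- 2εϖb, so ϖ would be a unit.
  have key : ∀ s : 𝔬, ε + algebraMap 𝔬 𝔒 s ∉ maximalIdeal 𝔒 := by
    intro s hs
    rw [hmax, Ideal.mem_span_singleton] at hs
    obtain ⟨z, hz⟩ := hs
    obtain ⟨a, b, rfl⟩ := hdec z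
    have hz' := congrArg σ hz
    simp only [map_add, map_mul, AlgEquiv.commutes, hconj] at hz'
    have h4 : (2 * ε) * (algebraMap 𝔬 𝔒 ϖ * algebraMap 𝔬 𝔒 b) = (2 * ε) * 1 := by
      linear_combination hz' - hz
    have h5 := mul_left_cancel₀ (mul_ne_zero htwo hε0) h4
    have h6 : algebraMap 𝔬 𝔒 ϖ ∈ maximalIdeal 𝔒 := by
      rw [hmax]; exact Ideal.mem_span_singleton_self _
    exact h6 (IsUnit.of_mul_eq_one _ h5)
  rcases (maximalIdeal.isMaximal 𝔒).isPrime.mem_or_mem hmem' with h | h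
  · refine key (-r) ?_
    rwa [map_neg, ← sub_eq_add_neg]
  · exact key r h

end Existence

/-! ### Norms and square classes of units -/

section Norm

variable {𝔬 𝔒 : Type*} [CommRing 𝔬] [IsLocalRing 𝔬] [IsAdicComplete (maximalIdeal 𝔬) 𝔬]
  [Finite (ResidueField 𝔬)] [CommRing 𝔒] [Algebra 𝔬 𝔒]
  {σ : 𝔒 ≃ₐ[𝔬] 𝔒} {ε : 𝔒} {u : 𝔬}

/-- Every unit of `𝔬` is a norm from `𝔒`. -/
theorem IsSkewGenerator.exists_norm_eq (h : IsSkewGenerator σ ε u)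
    (hodd : Odd (ringChar (ResidueField 𝔬))) {c : 𝔬} (hc : IsUnit c) :
    ∃ z : 𝔒, z * σ z = algebraMap 𝔬 𝔒 c := by
  have h2 := isUnit_two_of_odd_ringChar hodd
  have hchar : ringChar (ResidueField 𝔬) ≠ 2 := by
    intro h3; rw [h3] at hodd; exact absurd hodd (by decide)
  have : Fintype (ResidueField 𝔬) := Fintype.ofFinite _
  have hu0 : residue 𝔬 u ≠ 0 := fun h0 => h.not_isSquare (h0 ▸ IsSquare.zero)
  -- Counting in the finite residue field solves s² - ut² = c there.
  obtain ⟨s, t, hst⟩ := FiniteField.exists_root_sum_quadratic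
    (f := Polynomial.X ^ 2 - Polynomial.C (residue 𝔬 c))
    (g := Polynomial.C (-residue 𝔬 u) * Polynomial.X ^ 2)
    (Polynomial.degree_X_pow_sub_C two_pos _)
    (Polynomial.degree_C_mul_X_pow 2 (neg_ne_zero.2 hu0))
    (FiniteField.odd_card_of_char_ne_two hchar)
  obtain ⟨s, rfl⟩ := residue_surjective s
  obtain ⟨t, rfl⟩ := residue_surjective t
  simp only [Polynomial.eval_sub, Polynomial.eval_pow, Polynomial.eval_X, Polynomial.eval_C,
    Polynomial.eval_mul] at hst
  have hst' : residue 𝔬 (s ^ 2 - u * t ^ 2) = residue 𝔬 c := by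
    simp only [map_sub, map_mul, map_pow]
    linear_combination hst
  have hn : IsUnit (s ^ 2 - u * t ^ 2) := by
    rw [← isUnit_map_iff (residue 𝔬), hst']; exact hc.map _
  obtain ⟨n', hn'⟩ := hn.exists_right_inv
  have hres : residue 𝔬 (c * n') = 1 := by
    rw [map_mul, ← hst', ← map_mul, hn', map_one]
  have hcn : IsUnit (c * n') := hc.mul (IsUnit.of_mul_eq_one_right _ hn')
  -- The lifted norm differs from c by a factor congruent to 1, which is a square w² and is absorbed
  -- by scaling with w.
  obtain ⟨w, hw⟩ := isSquare_of_isSquare_residue h2 hcn (by rw [hres]; exact IsSquare.one)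
  refine ⟨algebraMap 𝔬 𝔒 w * (algebraMap 𝔬 𝔒 s + algebraMap 𝔬 𝔒 t * ε), ?_⟩
  have e : c = w * w * (s ^ 2 - u * t ^ 2) := by
    rw [← hw]; linear_combination -c * hn'
  rw [e]
  simp only [map_mul, map_add, map_sub, map_pow, AlgEquiv.commutes, h.conj_eq, ← h.sq_eq]
  ring

/-- Every unit is a square or becomes one after multiplication by the non-square `u`. -/
theorem IsSkewGenerator.isSquare_or_isSquare_mul (hε : IsSkewGenerator σ ε u)
    (h2 : IsUnit (2 : 𝔬)) {δ : 𝔬} (hδ : IsUnit δ) : IsSquare δ ∨ IsSquare (u * δ) := by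
  classical
  have : Fintype (ResidueField 𝔬) := Fintype.ofFinite _
  by_cases h : IsSquare (residue 𝔬 δ)
  · exact Or.inl (isSquare_of_isSquare_residue h2 hδ h)
  · refine Or.inr (isSquare_of_isSquare_residue h2 (hε.isUnit_sq.mul hδ) ?_)
    by_contra hn
    have e := map_mul (quadraticChar (ResidueField 𝔬)) (residue 𝔬 u) (residue 𝔬 δ)
    rw [← map_mul, quadraticChar_neg_one_iff_not_isSquare.2 hn,
      quadraticChar_neg_one_iff_not_isSquare.2 hε.not_isSquare,
      quadraticChar_neg_one_iff_not_isSquare.2 h] at e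
    norm_num at e

end Norm

theorem matrix_fin_two_congr {S : Type*} {a b c d a' b' c' d' : S} (h₁ : a = a') (h₂ : b = b')
    (h₃ : c = c') (h₄ : d = d') : !![a, b; c, d] = !![a', b'; c', d'] := by
  rw [h₁, h₂, h₃, h₄]

/-! ### Unitary conjugation -/

section Group

variable {𝔬 𝔒 : Type*} [CommRing 𝔬] [CommRing 𝔒] [IsLocalRing 𝔒] [Algebra 𝔬 𝔒]
  {σ : 𝔒 ≃ₐ[𝔬] 𝔒} {ℓ : ℕ}

theorem starOp_of (a b c d : QuotPow 𝔒 ℓ) :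
    starOp σ ℓ !![a, b; c, d] = !![conj σ ℓ d, conj σ ℓ b; conj σ ℓ c, conj σ ℓ a] := by
  have h : (!![a, b; c, d].map (conj σ ℓ))ᵀ =
      !![conj σ ℓ a, conj σ ℓ c; conj σ ℓ b, conj σ ℓ d] := by
    ext i j
    fin_cases i <;> fin_cases j <;> rfl
  rw [starOp, weyl_inv, h, weyl, Matrix.mul_fin_two, Matrix.mul_fin_two]
  simp

theorem starOp_mat_mul_mat (A : GU2 σ ℓ) : starOp σ ℓ (mat A) * mat A = 1 := A.2

theorem mat_mul_mat_inv (A : GU2 σ ℓ) : mat A * mat A⁻¹ = 1 :=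
  Units.mul_inv (A : GL (Fin 2) (QuotPow 𝔒 ℓ))

theorem mat_injective : Function.Injective (mat : GU2 σ ℓ → _) :=
  fun _ _ h => Subtype.ext (Units.ext h)

theorem mat_inv_eq {A : GU2 σ ℓ} {N : Matrix (Fin 2) (Fin 2) (QuotPow 𝔒 ℓ)}
    (h : mat A * N = 1) : mat A⁻¹ = N := by
  have h1 : mat A⁻¹ * mat A = 1 := mul_eq_one_comm.1 (mat_mul_mat_inv A)
  calc mat A⁻¹ = mat A⁻¹ * (mat A * N) := by rw [h, mul_one]
    _ = N := by rw [← mul_assoc, h1, one_mul]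

theorem mat_inv_eq_starOp (A : GU2 σ ℓ) : mat A⁻¹ = starOp σ ℓ (mat A) :=
  mat_inv_eq (mul_eq_one_comm.1 (starOp_mat_mul_mat A))

/-- A matrix intertwining `A` and `M`, unitary for the form, conjugates `A` to `M`. -/
theorem exists_isConj_mat_eq (A : GU2 σ ℓ) {g M : Matrix (Fin 2) (Fin 2) (QuotPow 𝔒 ℓ)}
    (hg : starOp σ ℓ g * g = 1) (h : mat A * g = g * M) :
    ∃ B : GU2 σ ℓ, IsConj A B ∧ mat B = M := by
  let G : GU2 σ ℓ := ⟨⟨g, starOp σ ℓ g, mul_eq_one_comm.1 hg, hg⟩, hg⟩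
  refine ⟨G⁻¹ * A * G, isConj_iff.2 ⟨G⁻¹, by rw [inv_inv]⟩, ?_⟩
  change starOp σ ℓ g * mat A * g = M
  rw [mul_assoc, h, ← mul_assoc, hg, one_mul]

theorem exists_mat_mul_eq_of_isConj {A B : GU2 σ ℓ} (h : IsConj A B) :
    ∃ G : GU2 σ ℓ, mat G * mat A * mat G⁻¹ = mat B := by
  obtain ⟨G, rfl⟩ := isConj_iff.1 h
  exact ⟨G, rfl⟩

theorem det_mat_eq_of_isConj {A B : GU2 σ ℓ} (h : IsConj A B) :
    (mat A).det = (mat B).det := by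
  obtain ⟨G, hG⟩ := exists_mat_mul_eq_of_isConj h
  rw [← hG, det_mul, det_mul, mul_right_comm, ← det_mul, mat_mul_mat_inv, det_one, one_mul]

theorem trace_mat_eq_of_isConj {A B : GU2 σ ℓ} (h : IsConj A B) :
    (mat A).trace = (mat B).trace := by
  obtain ⟨G, hG⟩ := exists_mat_mul_eq_of_isConj h
  rw [← hG, trace_mul_comm, ← mul_assoc, mul_eq_one_comm.1 (mat_mul_mat_inv G), one_mul]

theorem isRealElement_of_isConj {A B : GU2 σ ℓ} (h : IsConj A B) (hB : IsRealElement B) :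
    IsRealElement A := by
  have h1 : IsConj B⁻¹ A⁻¹ := by
    obtain ⟨G, rfl⟩ := isConj_iff.1 h.symm
    exact isConj_iff.2 ⟨G, by group⟩
  exact (h.trans hB).trans h1

theorem isRealElement_of_intertwine (A : GU2 σ ℓ) {g : Matrix (Fin 2) (Fin 2) (QuotPow 𝔒 ℓ)}
    (hg : starOp σ ℓ g * g = 1) (h : mat A * g = g * mat A⁻¹) : IsRealElement A := by
  obtain ⟨B, hB, h1⟩ := exists_isConj_mat_eq A hg h
  rw [mat_injective h1] at hB
  exact hB

end Group

/-! ### Passage from 𝔬 to the finite quotients -/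

section Reduction

variable {𝔬 𝔒 : Type*} [CommRing 𝔬] [CommRing 𝔒] [IsLocalRing 𝔒] [Algebra 𝔬 𝔒]
  {σ : 𝔒 ≃ₐ[𝔬] 𝔒} {ℓ : ℕ}

variable (𝔬 𝔒 ℓ) in
/-- The natural map `𝔬 → 𝔒_ℓ`. -/
def baseMap : 𝔬 →+* QuotPow 𝔒 ℓ :=
  (Ideal.Quotient.mk ((maximalIdeal 𝔒) ^ ℓ)).comp (algebraMap 𝔬 𝔒)

theorem conj_baseMap (x : 𝔬) : conj σ ℓ (baseMap 𝔬 𝔒 ℓ x) = baseMap 𝔬 𝔒 ℓ x :=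
  (conj_mk σ ℓ _).trans (congrArg _ (σ.commutes x))

theorem isLocalRing_quotPow (hℓ : 1 ≤ ℓ) : IsLocalRing (QuotPow 𝔒 ℓ) := by
  have h : (maximalIdeal 𝔒) ^ ℓ ≠ ⊤ := fun h => by
    have h1 := Ideal.pow_le_self (I := maximalIdeal 𝔒) (Nat.one_le_iff_ne_zero.1 hℓ)
    rw [h, top_le_iff] at h1
    exact (maximalIdeal.isMaximal 𝔒).ne_top h1
  have := Ideal.Quotient.nontrivial_iff.2 h
  exact IsLocalRing.of_surjective' _ Ideal.Quotient.mk_surjective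

theorem isUnit_of_isUnit_baseMap [IsLocalHom (algebraMap 𝔬 𝔒)] (hℓ : 1 ≤ ℓ) {x : 𝔬}
    (hx : IsUnit (baseMap 𝔬 𝔒 ℓ x)) : IsUnit x := by
  have := isLocalRing_quotPow (𝔒 := 𝔒) hℓ
  have := IsLocalHom.of_surjective (Ideal.Quotient.mk ((maximalIdeal 𝔒) ^ ℓ))
    Ideal.Quotient.mk_surjective
  exact (isUnit_of_map_unit _ _ (isUnit_of_map_unit (Ideal.Quotient.mk ((maximalIdeal 𝔒) ^ ℓ)) _ hx))

theorem isUnit_two_quotPow (h2 : IsUnit (2 : 𝔬)) : IsUnit (2 : QuotPow 𝔒 ℓ) := by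
  rw [← map_ofNat (baseMap 𝔬 𝔒 ℓ) 2]
  exact h2.map _

/-- As (x + 1) + (1 - x) = 2 is a unit, one factor of x² - 1 is a unit. -/
theorem eq_one_or_eq_neg_one_of_sq_eq_one {S : Type*} [CommRing S] [IsLocalRing S]
    (h2 : IsUnit (2 : S)) {x : S} (hx : x ^ 2 = 1) : x = 1 ∨ x = -1 := by
  have h : (x - 1) * (x + 1) = 0 := by linear_combination hx
  have h3 : IsUnit ((x + 1) + (1 - x)) := by
    convert h2 using 1
    ring
  rcases IsLocalRing.isUnit_or_isUnit_of_isUnit_add h3 with h4 | h4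
  · exact Or.inl (sub_eq_zero.1 (h4.mul_left_eq_zero.1 h))
  · refine Or.inr (eq_neg_of_add_eq_zero_left (h4.mul_right_eq_zero.1 ?_))
    linear_combination -h

end Reduction

/-! ### Normal form of primitive traceless skew matrices -/

section KeyLemma

variable {𝔬 𝔒 : Type*} [CommRing 𝔬] [IsLocalRing 𝔬] [CommRing 𝔒] [IsLocalRing 𝔒] [Algebra 𝔬 𝔒]
  {σ : 𝔒 ≃ₐ[𝔬] 𝔒} {ε : 𝔒} {u : 𝔬} {ℓ : ℕ}

theorem IsSkewGenerator.mk_sq (h : IsSkewGenerator σ ε u) :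
    (Ideal.Quotient.mk ((maximalIdeal 𝔒) ^ ℓ) ε) ^ 2 = baseMap 𝔬 𝔒 ℓ u := by
  rw [← map_pow, h.sq_eq]; rfl

theorem IsSkewGenerator.conj_mk_eq (h : IsSkewGenerator σ ε u) :
    conj σ ℓ (Ideal.Quotient.mk ((maximalIdeal 𝔒) ^ ℓ) ε) =
      -Ideal.Quotient.mk ((maximalIdeal 𝔒) ^ ℓ) ε := by
  rw [conj_mk, h.conj_eq, map_neg]

theorem IsSkewGenerator.exists_of_conj_eq (h : IsSkewGenerator σ ε u) (h2 : IsUnit (2 : 𝔬))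
    {x : QuotPow 𝔒 ℓ} (hx : conj σ ℓ x = x) : ∃ a, x = baseMap 𝔬 𝔒 ℓ a := by
  obtain ⟨z, rfl⟩ := Ideal.Quotient.mk_surjective x
  obtain ⟨a, b, rfl⟩ := h.exists_eq z
  refine ⟨a, ?_⟩
  obtain ⟨i, hi⟩ := h2.exists_right_inv
  have hi' := congrArg (baseMap 𝔬 𝔒 ℓ) hi
  simp only [map_mul, map_ofNat, map_one] at hi'
  simp only [map_add, map_mul, h.conj_mk_eq] at hx ⊢
  change conj σ ℓ (baseMap 𝔬 𝔒 ℓ a) + conj σ ℓ (baseMap 𝔬 𝔒 ℓ b) * _ =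
    baseMap 𝔬 𝔒 ℓ a + baseMap 𝔬 𝔒 ℓ b * _ at hx
  change baseMap 𝔬 𝔒 ℓ a + baseMap 𝔬 𝔒 ℓ b * _ = _
  rw [conj_baseMap, conj_baseMap] at hx
  linear_combination (-baseMap 𝔬 𝔒 ℓ i) * hx -
    baseMap 𝔬 𝔒 ℓ b * Ideal.Quotient.mk ((maximalIdeal 𝔒) ^ ℓ) ε * hi'

/-- Multiplication by the unit ε turns skew elements into fixed ones. -/
theorem IsSkewGenerator.exists_of_conj_eq_neg (h : IsSkewGenerator σ ε u)
    (h2 : IsUnit (2 : 𝔬)) {x : QuotPow 𝔒 ℓ} (hx : conj σ ℓ x = -x) :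
    ∃ a, x = baseMap 𝔬 𝔒 ℓ a * Ideal.Quotient.mk ((maximalIdeal 𝔒) ^ ℓ) ε := by
  obtain ⟨v, hv⟩ := h.isUnit_sq.exists_right_inv
  have hv' := congrArg (baseMap 𝔬 𝔒 ℓ) hv
  simp only [map_mul, map_one, ← h.mk_sq] at hv'
  obtain ⟨a, ha⟩ := h.exists_of_conj_eq h2
    (x := x * Ideal.Quotient.mk ((maximalIdeal 𝔒) ^ ℓ) ε)
    (by rw [map_mul, hx, h.conj_mk_eq, neg_mul_neg])
  refine ⟨a * v, ?_⟩
  rw [map_mul, ← ha]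
  linear_combination (-x) * hv'

/-- The unitary conjugation of a traceless skew matrix `(m, εb; εc, -m)` to the antidiagonal
matrix `(0, εk; ερ, 0)` with the same determinant. -/
theorem IsSkewGenerator.exists_intertwine_antidiagonal (h : IsSkewGenerator σ ε u)
    (hnorm : ∀ c : 𝔬, IsUnit c → ∃ z : 𝔒, z * σ z = algebraMap 𝔬 𝔒 c)
    (h2 : IsUnit (2 : 𝔬)) {m b c k ρ : 𝔬} (hρ : IsUnit ρ)
    (hu : IsUnit m ∨ IsUnit b ∨ IsUnit c) (hk : ρ * u * k = m ^ 2 + u * b * c) :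
    ∃ g : Matrix (Fin 2) (Fin 2) (QuotPow 𝔒 ℓ), starOp σ ℓ g * g = 1 ∧
      !![baseMap 𝔬 𝔒 ℓ m, baseMap 𝔬 𝔒 ℓ b * Ideal.Quotient.mk _ ε;
        baseMap 𝔬 𝔒 ℓ c * Ideal.Quotient.mk _ ε, -baseMap 𝔬 𝔒 ℓ m] * g =
      g * !![0, baseMap 𝔬 𝔒 ℓ k * Ideal.Quotient.mk _ ε;
        baseMap 𝔬 𝔒 ℓ ρ * Ideal.Quotient.mk _ ε, 0] := by
  -- With h(x, y) = x₁°y₂ + x₂°y₁ and X the matrix on the left, the vector (s, tε) is isotropic and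
  -- h((s, tε), X(s, tε)) = εq with q = cs² - 2mst - ubt². Primitivity of X makes q represent a
  -- unit: if b and c are non-units, q(1, 1) ≡ -2m.
  obtain ⟨s, t, hq⟩ : ∃ s t : 𝔬, IsUnit (c * s ^ 2 - 2 * m * s * t - u * b * t ^ 2) := by
    by_cases hc : IsUnit c
    · exact ⟨1, 0, by simpa using hc⟩
    by_cases hb : IsUnit b
    · exact ⟨0, 1, by simpa using h.isUnit_sq.mul hb⟩
    refine ⟨1, 1, ?_⟩
    have hm : IsUnit m := by tauto
    by_contra hq
    have hmem : c - (c * 1 ^ 2 - 2 * m * 1 * 1 - u * b * 1 ^ 2) - u * b ∈ maximalIdeal 𝔬 :=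
      sub_mem (sub_mem hc hq) (Ideal.mul_mem_left _ _ hb)
    refine hmem ?_
    convert h2.mul hm using 1
    ring
  obtain ⟨q', hq'⟩ := hq.exists_right_inv
  -- Scaling the vector by z multiplies q by zz°, so its value becomes ρ.
  obtain ⟨z, hz⟩ := hnorm (ρ * q') (hρ.mul (IsUnit.of_mul_eq_one_right _ hq'))
  obtain ⟨ρ', hρ'⟩ := hρ.exists_right_inv
  obtain ⟨v, hv⟩ := h.isUnit_sq.exists_right_inv
  have hzq : z * σ z * algebraMap 𝔬 𝔒 (c * s ^ 2 - 2 * m * s * t - u * b * t ^ 2) =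
      algebraMap 𝔬 𝔒 ρ := by
    rw [hz, ← map_mul]
    congr 1
    linear_combination ρ * hq'
  set f := baseMap 𝔬 𝔒 ℓ with hf
  set π := Ideal.Quotient.mk ((maximalIdeal 𝔒) ^ ℓ) with hπ
  set e := π ε with he
  have hzq' : π z * conj σ ℓ (π z) *
      (f c * f s ^ 2 - 2 * f m * f s * f t - f u * f b * f t ^ 2) = f ρ := by
    have := congrArg π hzq
    rw [map_mul, map_mul, ← conj_mk] at this
    change _ * f (c * s ^ 2 - 2 * m * s * t - u * b * t ^ 2) = f ρ at this
    simpa only [map_sub, map_mul, map_pow, map_ofNat] using this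
  have he2 : e ^ 2 = f u := h.mk_sq
  have hce : conj σ ℓ e = -e := h.conj_mk_eq
  have hvf : f u * f v = 1 := by rw [← map_mul, hv, map_one]
  have hρf : f ρ * f ρ' = 1 := by rw [← map_mul, hρ', map_one]
  have hkf : f ρ * f u * f k = f m ^ 2 + f u * f b * f c := by
    simpa only [map_add, map_mul, map_pow] using congrArg f hk
  have hcf : ∀ x, conj σ ℓ (f x) = f x := conj_baseMap
  set L := π z
  set L' := conj σ ℓ L
  -- The columns are w = z(s, tε) and (ερ)⁻¹Xw, with ε⁻¹ written as εv. They form a hyperbolic pair,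
  -- and X² = ρuk sends the second column to kεw.
  refine ⟨!![L * f s, L * f ρ' * (e * f v) * (f m * f s + f u * f b * f t);
    L * (e * f t), L * f ρ' * (f c * f s - f m * f t)], ?_, ?_⟩
  · rw [starOp_of, Matrix.mul_fin_two, Matrix.one_fin_two]
    simp only [map_mul, map_add, map_sub, hcf, hce]
    have key : L' * f ρ' * (f c * f s - f m * f t) * (L * f s) +
        L' * f ρ' * (-e * f v) * (f m * f s + f u * f b * f t) * (L * (e * f t)) = 1 := by
      linear_combination f ρ' * hzq' + hρf -
        L * L' * f ρ' * (f m * f s + f u * f b * f t) * f t * (f v * he2 + hvf)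
    refine matrix_fin_two_congr key ?_ ?_ ?_
    · change L' * f ρ' * (f c * f s - f m * f t) * (L * f ρ' * (e * f v) *
        (f m * f s + f u * f b * f t)) + L' * f ρ' * (-e * f v) *
        (f m * f s + f u * f b * f t) * (L * f ρ' * (f c * f s - f m * f t)) = 0
      ring
    · change L' * (-e * f t) * (L * f s) + L' * f s * (L * (e * f t)) = 0
      ring
    · change L' * (-e * f t) * (L * f ρ' * (e * f v) * (f m * f s + f u * f b * f t)) +
        L' * f s * (L * f ρ' * (f c * f s - f m * f t)) = 1
      linear_combination key
  · have he : e * (e * f v) = 1 := by linear_combination f v * he2 + hvf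
    have he3 : e = e * f v * f u := by linear_combination (-e) * hvf
    rw [Matrix.mul_fin_two, Matrix.mul_fin_two]
    refine matrix_fin_two_congr ?_ ?_ ?_ ?_
    · linear_combination L * f b * f t * he2 -
        L * (f m * f s + f u * f b * f t) * (e * (e * f v) * hρf + he)
    · linear_combination L * f ρ' * f b * (f c * f s - f m * f t) * he3 -
        L * f ρ' * (e * f v) * f s * hkf + L * (e * f v) * f s * f u * f k * hρf -
        L * f s * f k * he3
    · linear_combination (-L) * e * (f c * f s - f m * f t) * hρf
    · linear_combination f c * L * f ρ' * (f m * f s + f u * f b * f t) * he -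
        L * f ρ' * f t * hkf + L * f t * f u * f k * hρf - L * f t * f k * he2

end KeyLemma

/-! ### Criteria for reality -/

section Reality

variable {𝔬 𝔒 : Type*} [CommRing 𝔬] [CommRing 𝔒] [IsLocalRing 𝔒] [Algebra 𝔬 𝔒]
  {σ : 𝔒 ≃ₐ[𝔬] 𝔒} {ℓ : ℕ}

theorem det_trace_of_isRealElement (hℓ : 1 ≤ ℓ) (h2 : IsUnit (2 : 𝔬)) {A : GU2 σ ℓ}
    (h : IsRealElement A) :
    ((mat A).det = 1 ∨ (mat A).det = -1) ∧ (mat A).trace = (mat A⁻¹).trace := by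
  have := isLocalRing_quotPow (𝔒 := 𝔒) hℓ
  refine ⟨eq_one_or_eq_neg_one_of_sq_eq_one ?_ ?_, trace_mat_eq_of_isConj h⟩
  · exact isUnit_two_quotPow h2
  · rw [sq]
    nth_rewrite 2 [det_mat_eq_of_isConj h]
    rw [← det_mul, mat_mul_mat_inv, det_one]

theorem isRealElement_of_mat_eq_diagonal (B : GU2 σ ℓ) {x y : QuotPow 𝔒 ℓ} (hxy : x * y = 1)
    (hB : mat B = !![x, 0; 0, y]) : IsRealElement B := by
  have hi : mat B⁻¹ = !![y, 0; 0, x] := by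
    refine mat_inv_eq ?_
    rw [hB, mul_fin_two, one_fin_two]
    exact matrix_fin_two_congr (by linear_combination hxy) (by ring) (by ring)
      (by linear_combination hxy)
  refine isRealElement_of_intertwine B (g := !![0, 1; 1, 0]) ?_ ?_
  · rw [starOp_of, mul_fin_two, one_fin_two]
    simp
  · rw [hi, hB, mul_fin_two, mul_fin_two]
    simp

/-- Conjugation by diag(w, -w) negates the off-diagonal entries, which here is inversion; this
matrix is unitary because ww° = -1. -/
theorem isRealElement_of_mat_eq_of_diag_eq (hnorm : ∃ z : 𝔒, z * σ z = -1) (B : GU2 σ ℓ)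
    {x b c : QuotPow 𝔒 ℓ} (hdet : x ^ 2 - b * c = 1) (hB : mat B = !![x, b; c, x]) :
    IsRealElement B := by
  obtain ⟨z, hz⟩ := hnorm
  have hi : mat B⁻¹ = !![x, -b; -c, x] := by
    refine mat_inv_eq ?_
    rw [hB, mul_fin_two, one_fin_two]
    exact matrix_fin_two_congr (by linear_combination hdet) (by ring) (by ring)
      (by linear_combination hdet)
  set w : QuotPow 𝔒 ℓ := Ideal.Quotient.mk _ z with hw
  have hz' : w * conj σ ℓ w = -1 := by
    rw [hw, conj_mk, ← map_mul, hz, map_neg, map_one]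
  refine isRealElement_of_intertwine B (g := !![w, 0; 0, -w]) ?_ ?_
  · rw [starOp_of, mul_fin_two, one_fin_two]
    simp only [map_neg, map_zero]
    exact matrix_fin_two_congr (by linear_combination -hz') (by ring) (by ring)
      (by linear_combination -hz')
  · rw [hi, hB, mul_fin_two, mul_fin_two]
    exact matrix_fin_two_congr (by ring) (by ring) (by ring) (by ring)

/-- Both A^⋆ and s times the adjugate are the inverse of A. With s = ±1 every entry becomes fixed or
skew. -/
theorem adjugate_entries_of_det_sq {A : GU2 σ ℓ} {a b c d s : QuotPow 𝔒 ℓ}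
    (hA : mat A = !![a, b; c, d]) (hs : s * (mat A).det = 1) :
    conj σ ℓ d = s * d ∧ conj σ ℓ b = -(s * b) ∧ conj σ ℓ c = -(s * c) ∧
      conj σ ℓ a = s * a := by
  have h1 : mat A⁻¹ = !![s * d, -(s * b); -(s * c), s * a] := by
    refine mat_inv_eq ?_
    rw [hA, det_fin_two_of] at hs
    rw [hA, mul_fin_two, one_fin_two]
    exact matrix_fin_two_congr (by linear_combination hs) (by ring) (by ring)
      (by linear_combination hs)
  rw [mat_inv_eq_starOp, hA, starOp_of] at h1
  exact ⟨congrFun (congrFun h1 0) 0, congrFun (congrFun h1 0) 1,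
    congrFun (congrFun h1 1) 0, congrFun (congrFun h1 1) 1⟩

end Reality

/-! ### Reality of the listed forms; determinant -1 -/

section Forms

variable {𝔬 𝔒 : Type*} [CommRing 𝔬] [IsLocalRing 𝔬] [CommRing 𝔒] [IsLocalRing 𝔒]
  [Algebra 𝔬 𝔒] [Algebra.IsQuadraticExtension 𝔬 𝔒] {σ : 𝔒 ≃ₐ[𝔬] 𝔒} {ℓ : ℕ}

theorem isRealElement_of_form (hnorm : ∃ z : 𝔒, z * σ z = -1) {ϖ : 𝔬} (hϖ : Irreducible ϖ)
    {B : GU2 σ ℓ} (h : FormA B ∨ FormB B ∨ FormC B ∨ FormD hϖ B) : IsRealElement B := by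
  rcases h with ⟨x, hx, hB⟩ | ⟨x, -, hB⟩ | (hB | ⟨x, y, -, -, -, h1, hB⟩) |
    ⟨i, -, β, x, y, -, h1, -, hB⟩
  · refine isRealElement_of_mat_eq_diagonal B ?_ hB
    rcases hx with rfl | rfl <;> ring
  · refine isRealElement_of_mat_eq_diagonal B ?_ hB
    rw [← map_mul, Units.mul_inv, map_one]
  · have hi : B⁻¹ = B := by
      refine mat_injective (mat_inv_eq ?_)
      rw [hB, mul_fin_two, one_fin_two]
      simp
    rw [IsRealElement, hi]
  · exact isRealElement_of_mat_eq_of_diag_eq hnorm B (by linear_combination h1) hB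
  · exact isRealElement_of_mat_eq_of_diag_eq hnorm B (by linear_combination h1) hB

theorem exists_isConj_weyl_of_det_eq_neg_one {ε : 𝔒} {u : 𝔬} (hε : IsSkewGenerator σ ε u)
    (hnorm : ∀ c : 𝔬, IsUnit c → ∃ z : 𝔒, z * σ z = algebraMap 𝔬 𝔒 c)
    (h2 : IsUnit (2 : 𝔬)) (hℓ : 1 ≤ ℓ) {A : GU2 σ ℓ} (hdet : (mat A).det = -1)
    (htr : (mat A).trace = (mat A⁻¹).trace) :
    ∃ B : GU2 σ ℓ, IsConj A B ∧ mat B = !![0, 1; 1, 0] := by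
  obtain ⟨a, b, c, d, hA⟩ : ∃ a b c d, mat A = !![a, b; c, d] := ⟨_, _, _, _, eta_fin_two _⟩
  obtain ⟨hd, hb, hc, ha⟩ := adjugate_entries_of_det_sq (s := -1) hA (by rw [hdet]; ring)
  have h2' : IsUnit (2 : QuotPow 𝔒 ℓ) := isUnit_two_quotPow h2
  -- Here tr(A⁻¹) = a° + d° = -(a + d), so 2(a + d) = 0.
  have hda : d = -a := by
    rw [mat_inv_eq_starOp, hA, starOp_of, trace_fin_two_of, trace_fin_two_of, hd, ha] at htr
    refine h2'.mul_left_cancel ?_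
    linear_combination htr
  subst hda
  obtain ⟨a, rfl⟩ := hε.exists_of_conj_eq_neg h2 (ha.trans (by ring))
  obtain ⟨b, rfl⟩ := hε.exists_of_conj_eq h2 (hb.trans (by ring))
  obtain ⟨c, rfl⟩ := hε.exists_of_conj_eq h2 (hc.trans (by ring))
  obtain ⟨v, hv⟩ := hε.isUnit_sq.exists_right_inv
  have he2 := hε.mk_sq (ℓ := ℓ)
  set f := baseMap 𝔬 𝔒 ℓ
  set e := Ideal.Quotient.mk ((maximalIdeal 𝔒) ^ ℓ) ε with he
  have hvf : f u * f v = 1 := by rw [← map_mul, hv, map_one]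
  rw [hA, det_fin_two_of] at hdet
  have hdet' : f (u * a ^ 2 + b * c) = 1 := by
    simp only [map_add, map_mul, map_pow]
    linear_combination -hdet - f a ^ 2 * he2
  have hun : IsUnit (u * a ^ 2 + b * c) :=
    isUnit_of_isUnit_baseMap hℓ (hdet' ▸ isUnit_one)
  have hv1 : IsUnit v := IsUnit.of_mul_eq_one_right _ hv
  have hex : IsUnit a ∨ IsUnit (v * b) ∨ IsUnit (v * c) := by
    by_contra! hcon
    obtain ⟨h1, h3, -⟩ := hcon
    have h1' : a ∈ maximalIdeal 𝔬 := h1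
    have h3' : b ∈ maximalIdeal 𝔬 := fun hb => h3 (hv1.mul hb)
    refine (mem_nonunits_iff.1 ((mem_maximalIdeal _).1 (add_mem ?_ ?_))) hun
    · rw [sq, ← mul_assoc]
      exact Ideal.mul_mem_left _ _ h1'
    · exact Ideal.mul_mem_right _ _ h3'
  -- Applied to X = ε⁻¹A with ρ = v = u⁻¹. The determinant condition makes k equal to v in 𝔒_ℓ, and
  -- ε(0, vε; vε, 0) = `W`.
  obtain ⟨g, hg, hint⟩ := hε.exists_intertwine_antidiagonal (ℓ := ℓ) hnorm h2
    (k := a ^ 2 + u * (v * b) * (v * c)) hv1 hex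
    (by linear_combination (a ^ 2 + u * (v * b) * (v * c)) * hv)
  refine exists_isConj_mat_eq A hg ?_
  have hk : f (a ^ 2 + u * (v * b) * (v * c)) = f v := by
    have : a ^ 2 + u * (v * b) * (v * c) = v * (u * a ^ 2 + b * c) := by
      linear_combination (v * b * c - a ^ 2) * hv
    rw [this, map_mul, hdet', mul_one]
  rw [hk] at hint
  have hE : e • !![f a, f (v * b) * e; f (v * c) * e, -f a] = mat A := by
    rw [hA, smul_of, smul_cons, smul_cons, smul_cons, smul_cons]
    simp only [smul_cons, smul_empty, smul_eq_mul, map_mul]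
    exact matrix_fin_two_congr (by ring)
      (by linear_combination f v * f b * he2 + f b * hvf)
      (by linear_combination f v * f c * he2 + f c * hvf) (by ring)
  have hE' : e • !![0, f v * e; f v * e, 0] = !![0, 1; 1, 0] := by
    simp only [smul_of, smul_cons, smul_empty, smul_eq_mul]
    exact matrix_fin_two_congr (by ring) (by linear_combination f v * he2 + hvf)
      (by linear_combination f v * he2 + hvf) (by ring)
  rw [← hE, smul_mul_assoc, hint, ← mul_smul_comm, hE']

/-- Three elements, not all divisible by `ϖ ^ n`, have a common factor `ϖ ^ i` with `i < n` after
whose removal one of them is a unit. -/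
theorem exists_common_factor {R : Type*} [CommRing R] [IsLocalRing R] {ϖ : R}
    (hϖ : maximalIdeal R = Ideal.span {ϖ}) (m b c : R) (n : ℕ) :
    (∃ i < n, ∃ m₀ b₀ c₀, m = ϖ ^ i * m₀ ∧ b = ϖ ^ i * b₀ ∧ c = ϖ ^ i * c₀ ∧
      (IsUnit m₀ ∨ IsUnit b₀ ∨ IsUnit c₀)) ∨ (ϖ ^ n ∣ m ∧ ϖ ^ n ∣ b ∧ ϖ ^ n ∣ c) := by
  have hdvd : ∀ x : R, ¬ IsUnit x → ϖ ∣ x := fun x hx => by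
    rw [← Ideal.mem_span_singleton, ← hϖ]
    exact hx
  induction n with
  | zero => simp
  | succ n ih =>
    rcases ih with ⟨i, hi, h⟩ | ⟨⟨m₀, rfl⟩, ⟨b₀, rfl⟩, ⟨c₀, rfl⟩⟩
    · exact Or.inl ⟨i, hi.trans n.lt_succ_self, h⟩
    · by_cases h : IsUnit m₀ ∨ IsUnit b₀ ∨ IsUnit c₀
      · exact Or.inl ⟨n, n.lt_succ_self, m₀, b₀, c₀, rfl, rfl, rfl, h⟩
      · push Not at h
        simp only [pow_succ]
        exact Or.inr ⟨mul_dvd_mul_left _ (hdvd _ h.1), mul_dvd_mul_left _ (hdvd _ h.2.1),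
          mul_dvd_mul_left _ (hdvd _ h.2.2)⟩

end Forms

/-! ### Determinant 1: recognizing the four families -/

section ScalarDiagonal

variable {𝔬 𝔒 : Type*} [CommRing 𝔬] [CommRing 𝔒] [IsLocalRing 𝔒] [Algebra 𝔬 𝔒]
  {σ : 𝔒 ≃ₐ[𝔬] 𝔒} {ℓ : ℕ}

theorem formA_of_mat_eq_scalar (hℓ : 1 ≤ ℓ) (h2 : IsUnit (2 : 𝔬)) {B : GU2 σ ℓ}
    {x : QuotPow 𝔒 ℓ} (hx : x ^ 2 = 1) (hB : mat B = !![x, 0; 0, x]) : FormA B := by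
  have := isLocalRing_quotPow (𝔒 := 𝔒) hℓ
  exact ⟨x, eq_one_or_eq_neg_one_of_sq_eq_one (isUnit_two_quotPow h2) hx, hB⟩

/-- The off-diagonal entry may vanish in 𝔒_ℓ; that degenerate case is scalar and belongs to (a). -/
theorem formA_or_formC_of_mat_eq [IsLocalRing 𝔬] {ε : 𝔒} {u : 𝔬} (hε : IsSkewGenerator σ ε u)
    (hℓ : 1 ≤ ℓ) (h2 : IsUnit (2 : 𝔬)) {B : GU2 σ ℓ} {x y : 𝔬} (hdet : (mat B).det = 1)
    (hB : mat B = !![baseMap 𝔬 𝔒 ℓ x, baseMap 𝔬 𝔒 ℓ y * Ideal.Quotient.mk _ ε;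
      baseMap 𝔬 𝔒 ℓ y * Ideal.Quotient.mk _ ε, baseMap 𝔬 𝔒 ℓ x]) : FormA B ∨ FormC B := by
  rw [hB, det_fin_two_of] at hdet
  by_cases hy : baseMap 𝔬 𝔒 ℓ y * Ideal.Quotient.mk _ ε = 0
  · left
    rw [hy] at hB hdet
    exact formA_of_mat_eq_scalar hℓ h2 (by linear_combination hdet) hB
  · right
    refine Or.inr ⟨_, _, hy, ?_, ?_, by linear_combination hdet, hB⟩
    · rw [map_mul, conj_baseMap, conj_baseMap, hε.conj_mk_eq]
      linear_combination hdet
    · rw [map_mul, conj_baseMap, conj_baseMap, hε.conj_mk_eq]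
      ring

end ScalarDiagonal

section Classification

variable {𝔬 𝔒 : Type*} [CommRing 𝔬] [IsLocalRing 𝔬] [CommRing 𝔒] [IsLocalRing 𝔒]
  [Algebra 𝔬 𝔒] [Algebra.IsQuadraticExtension 𝔬 𝔒] {σ : 𝔒 ≃ₐ[𝔬] 𝔒} {ℓ : ℕ}

theorem formA_or_formB_of_mat_eq (hℓ : 1 ≤ ℓ) (h2 : IsUnit (2 : 𝔬)) {B : GU2 σ ℓ} {x y : 𝔬}
    (hxy : baseMap 𝔬 𝔒 ℓ x * baseMap 𝔬 𝔒 ℓ y = 1)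
    (hB : mat B = !![baseMap 𝔬 𝔒 ℓ x, 0; 0, baseMap 𝔬 𝔒 ℓ y]) : FormA B ∨ FormB B := by
  have := isLocalRing_quotPow (𝔒 := 𝔒) hℓ
  have hx : IsUnit x := isUnit_of_isUnit_baseMap hℓ (IsUnit.of_mul_eq_one _ hxy)
  obtain ⟨x₀, hx₀⟩ := hx.map (Ideal.Quotient.mk ((maximalIdeal 𝔬) ^ ℓ))
  have hx1 : incl 𝔬 𝔒 ℓ x₀.val = baseMap 𝔬 𝔒 ℓ x := by rw [hx₀]; rfl
  have hy1 : incl 𝔬 𝔒 ℓ (x₀⁻¹).val = baseMap 𝔬 𝔒 ℓ y := by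
    have h1 : incl 𝔬 𝔒 ℓ x₀.val * incl 𝔬 𝔒 ℓ (x₀⁻¹).val = 1 := by
      rw [← map_mul, Units.mul_inv, map_one]
    rw [hx1] at h1
    linear_combination baseMap 𝔬 𝔒 ℓ y * h1 - incl 𝔬 𝔒 ℓ (x₀⁻¹).val * hxy
  by_cases hsq : x₀ ^ 2 = 1
  · left
    have h1 : baseMap 𝔬 𝔒 ℓ x ^ 2 = 1 := by
      rw [← hx1, ← map_pow, ← Units.val_pow_eq_pow_val, hsq, Units.val_one, map_one]
    refine ⟨_, eq_one_or_eq_neg_one_of_sq_eq_one (isUnit_two_quotPow h2) h1, ?_⟩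
    rw [hB]
    exact matrix_fin_two_congr rfl rfl rfl
      (by linear_combination baseMap 𝔬 𝔒 ℓ x * hxy - baseMap 𝔬 𝔒 ℓ y * h1)
  · right
    exact ⟨x₀, hsq, by rw [hx1, hy1, hB]⟩

variable {ε : 𝔒} {u : 𝔬}

theorem formD_of_mat_eq (hε : IsSkewGenerator σ ε u) (hℓ : 1 ≤ ℓ) {ϖ : 𝔬}
    (hϖ : Irreducible ϖ) {B : GU2 σ ℓ} {x β : 𝔬} {i : ℕ} (hi : i < ℓ) (hdet : (mat B).det = 1)
    (hB : mat B = !![baseMap 𝔬 𝔒 ℓ x, baseMap 𝔬 𝔒 ℓ (ϖ ^ (i + 1) * β) * Ideal.Quotient.mk _ ε;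
      baseMap 𝔬 𝔒 ℓ (ϖ ^ i) * Ideal.Quotient.mk _ ε, baseMap 𝔬 𝔒 ℓ x]) : FormD hϖ B := by
  rw [hB, det_fin_two_of] at hdet
  have he2 := hε.mk_sq (ℓ := ℓ)
  -- Otherwise x² - ϖ²ⁱ⁺¹βu would lie in 𝔭 and yet map to 1 in 𝔒_ℓ.
  have hx : IsUnit x := by
    by_contra hx
    have h1 : baseMap 𝔬 𝔒 ℓ (x * x - ϖ * (ϖ ^ i * ϖ ^ i * β * u)) = 1 := by
      rw [← hdet]
      simp only [map_sub, map_mul, ← he2, pow_succ]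
      ring
    have h2 := isUnit_of_isUnit_baseMap hℓ (h1 ▸ isUnit_one)
    refine (mem_nonunits_iff.1 ((mem_maximalIdeal _).1 (sub_mem ?_ ?_))) h2
    · exact Ideal.mul_mem_left _ _ hx
    · exact Ideal.mul_mem_right _ _ hϖ.not_isUnit
  obtain ⟨x₀, hx₀⟩ := hx.map (Ideal.Quotient.mk ((maximalIdeal 𝔬) ^ ℓ))
  obtain ⟨y₀, hy₀⟩ := hε.isUnit.map (Ideal.Quotient.mk ((maximalIdeal 𝔒) ^ ℓ))
  have hx1 : incl 𝔬 𝔒 ℓ x₀.val = baseMap 𝔬 𝔒 ℓ x := by rw [hx₀]; rfl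
  refine ⟨i, hi, Ideal.Quotient.mk _ β, x₀, y₀, ?_⟩
  have hb : incl 𝔬 𝔒 ℓ (mulPow hϖ ℓ (i + 1) (Ideal.Quotient.mk _ β)) =
    baseMap 𝔬 𝔒 ℓ (ϖ ^ (i + 1) * β) := rfl
  have hp : incl 𝔬 𝔒 ℓ (Ideal.Quotient.mk _ (ϖ ^ i)) = baseMap 𝔬 𝔒 ℓ (ϖ ^ i) := rfl
  simp only [hb, hp, hx1, hy₀, hε.conj_mk_eq, conj_baseMap]
  exact ⟨by linear_combination hdet, by linear_combination hdet, by ring, hB⟩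

/-- Elements of determinant one are conjugate to one of the four forms. -/
theorem exists_isConj_form_of_det_eq_one [IsAdicComplete (maximalIdeal 𝔬) 𝔬]
    [Finite (ResidueField 𝔬)] (hε : IsSkewGenerator σ ε u)
    (hnorm : ∀ c : 𝔬, IsUnit c → ∃ z : 𝔒, z * σ z = algebraMap 𝔬 𝔒 c)
    (h2 : IsUnit (2 : 𝔬)) (hℓ : 1 ≤ ℓ) {ϖ : 𝔬} (hϖ : Irreducible ϖ)
    (hmax : maximalIdeal 𝔬 = Ideal.span {ϖ}) {A : GU2 σ ℓ} (hdet : (mat A).det = 1) :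
    ∃ B : GU2 σ ℓ, IsConj A B ∧ (FormA B ∨ FormB B ∨ FormC B ∨ FormD hϖ B) := by
  obtain ⟨a, b, c, d, hA⟩ : ∃ a b c d, mat A = !![a, b; c, d] := ⟨_, _, _, _, eta_fin_two _⟩
  obtain ⟨hd, hb, hc, ha⟩ := adjugate_entries_of_det_sq (s := 1) hA (by rw [hdet]; ring)
  obtain ⟨a, rfl⟩ := hε.exists_of_conj_eq h2 (ha.trans (by ring))
  obtain ⟨d, rfl⟩ := hε.exists_of_conj_eq h2 (hd.trans (by ring))
  obtain ⟨b, rfl⟩ := hε.exists_of_conj_eq_neg h2 (hb.trans (by ring))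
  obtain ⟨c, rfl⟩ := hε.exists_of_conj_eq_neg h2 (hc.trans (by ring))
  obtain ⟨j, hj⟩ := h2.exists_right_inv
  obtain ⟨v, hv⟩ := hε.isUnit_sq.exists_right_inv
  have he2 := hε.mk_sq (ℓ := ℓ)
  have hce := hε.conj_mk_eq (ℓ := ℓ)
  set e := Ideal.Quotient.mk ((maximalIdeal 𝔒) ^ ℓ) ε with he
  have hvf : baseMap 𝔬 𝔒 ℓ u * baseMap 𝔬 𝔒 ℓ v = 1 := by rw [← map_mul, hv, map_one]
  have hjf : 2 * baseMap 𝔬 𝔒 ℓ j = 1 := by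
    rw [← map_ofNat (baseMap 𝔬 𝔒 ℓ), ← map_mul, hj, map_one]
  obtain ⟨τ, hτ⟩ : ∃ τ, τ = (a + d) * j := ⟨_, rfl⟩
  have haτ : a = τ + (a - d) * j := by rw [hτ]; linear_combination -a * hj
  have hdτ : d = τ - (a - d) * j := by rw [hτ]; linear_combination -d * hj
  -- τ is half the trace. Divisibility by ϖ^ℓ means vanishing in 𝔒_ℓ, so the second alternative is
  -- the scalar case.
  rcases exists_common_factor hmax ((a - d) * j) b c ℓ with
    ⟨i, hi, m₀, b₀, c₀, hm, hb', hc', hu⟩ | ⟨hm, hb', hc'⟩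
  · rw [hm] at haτ hdτ
    subst haτ hdτ hb' hc'
    have hconj : ∀ ρ k : 𝔬, IsUnit ρ → ρ * u * k = m₀ ^ 2 + u * b₀ * c₀ →
        ∃ B : GU2 σ ℓ, IsConj A B ∧ mat B =
          !![baseMap 𝔬 𝔒 ℓ τ, baseMap 𝔬 𝔒 ℓ (ϖ ^ i * k) * e;
            baseMap 𝔬 𝔒 ℓ (ϖ ^ i * ρ) * e, baseMap 𝔬 𝔒 ℓ τ] := by
      intro ρ k hρ hk
      obtain ⟨g, hg, hint⟩ := hε.exists_intertwine_antidiagonal (ℓ := ℓ) hnorm h2 hρ hu hk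
      refine exists_isConj_mat_eq A hg ?_
      have e1 : mat A = baseMap 𝔬 𝔒 ℓ τ • 1 + baseMap 𝔬 𝔒 ℓ (ϖ ^ i) •
          !![baseMap 𝔬 𝔒 ℓ m₀, baseMap 𝔬 𝔒 ℓ b₀ * e;
            baseMap 𝔬 𝔒 ℓ c₀ * e, -baseMap 𝔬 𝔒 ℓ m₀] := by
        rw [hA, one_fin_two]
        simp only [smul_of, smul_cons, smul_empty, smul_eq_mul, of_add_of, add_cons,
          empty_add_empty, head_cons, tail_cons, map_add, map_sub, map_mul]
        exact matrix_fin_two_congr (by ring) (by ring) (by ring) (by ring)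
      have e2 : !![baseMap 𝔬 𝔒 ℓ τ, baseMap 𝔬 𝔒 ℓ (ϖ ^ i * k) * e;
            baseMap 𝔬 𝔒 ℓ (ϖ ^ i * ρ) * e, baseMap 𝔬 𝔒 ℓ τ] =
          baseMap 𝔬 𝔒 ℓ τ • 1 + baseMap 𝔬 𝔒 ℓ (ϖ ^ i) •
          !![0, baseMap 𝔬 𝔒 ℓ k * e; baseMap 𝔬 𝔒 ℓ ρ * e, 0] := by
        rw [one_fin_two]
        simp only [smul_of, smul_cons, smul_empty, smul_eq_mul, of_add_of, add_cons,
          empty_add_empty, head_cons, tail_cons, map_mul]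
        exact matrix_fin_two_congr (by ring) (by ring) (by ring) (by ring)
      rw [e1, e2, add_mul, mul_add, smul_mul_assoc, smul_mul_assoc, hint, one_mul,
        mul_smul_comm, mul_smul_comm, mul_one]
    by_cases hδ : IsUnit (m₀ ^ 2 + u * b₀ * c₀)
    · rcases hε.isSquare_or_isSquare_mul h2 hδ with ⟨r, hr⟩ | ⟨w, hw⟩
      · have hr1 : IsUnit r := by rw [hr] at hδ; exact isUnit_of_mul_isUnit_left hδ
        -- With ρ = r and k = r/u the antidiagonal part has eigenvectors (1, ε) and (-ε⁻¹, 1)/2 for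
        -- the eigenvalues r and -r; the factor j = 1/2 makes them pair to 1.
        obtain ⟨B, hAB, hB⟩ := hconj r (r * v) hr1 (by rw [hr]; linear_combination r * r * hv)
        obtain ⟨C, hBC, hC⟩ := exists_isConj_mat_eq B
          (g := !![1, -(baseMap 𝔬 𝔒 ℓ j * (e * baseMap 𝔬 𝔒 ℓ v)); e, baseMap 𝔬 𝔒 ℓ j])
          (M := !![baseMap 𝔬 𝔒 ℓ (τ + ϖ ^ i * r), 0; 0, baseMap 𝔬 𝔒 ℓ (τ - ϖ ^ i * r)])
          (by
            rw [starOp_of, mul_fin_two, one_fin_two]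
            simp only [map_mul, map_neg, map_one, conj_baseMap, hce]
            exact matrix_fin_two_congr
              (by linear_combination baseMap 𝔬 𝔒 ℓ j * baseMap 𝔬 𝔒 ℓ v * he2 +
                    baseMap 𝔬 𝔒 ℓ j * hvf + hjf)
              (by ring) (by ring)
              (by linear_combination baseMap 𝔬 𝔒 ℓ j * baseMap 𝔬 𝔒 ℓ v * he2 +
                    baseMap 𝔬 𝔒 ℓ j * hvf + hjf))
          (by
            rw [hB, mul_fin_two, mul_fin_two]
            simp only [map_mul, map_add, map_sub]
            generalize baseMap 𝔬 𝔒 ℓ (ϖ ^ i) = p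
            exact matrix_fin_two_congr
              (by linear_combination p * baseMap 𝔬 𝔒 ℓ r * (baseMap 𝔬 𝔒 ℓ v * he2 + hvf))
              (by ring)
              (by ring)
              (by linear_combination (-p) * baseMap 𝔬 𝔒 ℓ r * baseMap 𝔬 𝔒 ℓ j *
                    (baseMap 𝔬 𝔒 ℓ v * he2 + hvf)))
        have hdC := det_mat_eq_of_isConj (hAB.trans hBC)
        rw [hdet, hC, det_fin_two_of] at hdC
        refine ⟨C, hAB.trans hBC, ?_⟩
        have := formA_or_formB_of_mat_eq hℓ h2 (by linear_combination -hdC) hC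
        tauto
      · have hw1 : IsUnit w := by
          have := hε.isUnit_sq.mul hδ
          rw [hw] at this
          exact isUnit_of_mul_isUnit_left this
        -- From uδ = w², the choice ρ = k = w/u satisfies ρuk = δ and equalizes the off-diagonal
        -- entries.
        obtain ⟨B, hAB, hB⟩ := hconj (w * v) (w * v)
          (hw1.mul (IsUnit.of_mul_eq_one_right _ hv)) (by
            linear_combination (-v) * hw + (w * w * v + m₀ ^ 2 + u * b₀ * c₀) * hv)
        have hdB := det_mat_eq_of_isConj hAB
        have := formA_or_formC_of_mat_eq hε hℓ h2 (hdB.symm.trans hdet) hB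
        exact ⟨B, hAB, by tauto⟩
    · have hδ' : m₀ ^ 2 + u * b₀ * c₀ ∈ maximalIdeal 𝔬 := hδ
      rw [hmax, Ideal.mem_span_singleton] at hδ'
      obtain ⟨δ, hδ'⟩ := hδ'
      -- With ρ = 1, the factor ϖ of the non-unit m₀² + ub₀c₀ passes to k, giving ϖⁱ⁺¹ in the upper
      -- corner.
      obtain ⟨B, hAB, hB⟩ := hconj 1 (v * (ϖ * δ)) isUnit_one
        (by rw [hδ']; linear_combination ϖ * δ * hv)
      refine ⟨B, hAB, Or.inr (Or.inr (Or.inr ?_))⟩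
      refine formD_of_mat_eq hε hℓ hϖ (x := τ) (β := v * δ) hi
        ((det_mat_eq_of_isConj hAB).symm.trans hdet) ?_
      rw [hB, mul_one]
      congr 5
      ring_nf
  · have hzero : ∀ x : 𝔬, ϖ ^ ℓ ∣ x → baseMap 𝔬 𝔒 ℓ x = 0 := by
      rintro _ ⟨x, rfl⟩
      refine Ideal.Quotient.eq_zero_iff_mem.2 (maximalIdeal_pow_le_comap 𝔬 𝔒 ℓ ?_)
      exact Ideal.mul_mem_right _ _
        (Ideal.pow_mem_pow ((mem_maximalIdeal ϖ).2 hϖ.not_isUnit) ℓ)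
    have ha' : baseMap 𝔬 𝔒 ℓ a = baseMap 𝔬 𝔒 ℓ τ := by
      rw [haτ, map_add, hzero _ hm, add_zero]
    have hd' : baseMap 𝔬 𝔒 ℓ d = baseMap 𝔬 𝔒 ℓ τ := by
      rw [hdτ, map_sub, hzero _ hm, sub_zero]
    rw [ha', hd', hzero _ hb', hzero _ hc', zero_mul] at hA
    rw [hA, det_fin_two_of] at hdet
    exact ⟨A, IsConj.refl A,
      Or.inl (formA_of_mat_eq_scalar hℓ h2 (by linear_combination hdet) hA)⟩

end Classification

end UnitaryReal

theorem mainTheorem5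
    {𝔬 𝔒 : Type*}
    [CommRing 𝔬] [IsDomain 𝔬] [IsDiscreteValuationRing 𝔬]
    [IsAdicComplete (IsLocalRing.maximalIdeal 𝔬) 𝔬]
    [Finite (IsLocalRing.ResidueField 𝔬)]
    (hodd : Odd (ringChar (IsLocalRing.ResidueField 𝔬)))
    [CommRing 𝔒] [IsDomain 𝔒] [IsDiscreteValuationRing 𝔒]
    [Algebra 𝔬 𝔒] [Algebra.IsQuadraticExtension 𝔬 𝔒] [Algebra.FormallyUnramified 𝔬 𝔒]
    (σ : 𝔒 ≃ₐ[𝔬] 𝔒) (hσ : σ ≠ AlgEquiv.refl)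
    (ϖ : 𝔬) (hϖ : Irreducible ϖ)
    (ℓ : ℕ) (hℓ : 1 ≤ ℓ)
    (A : UnitaryReal.GU2 σ ℓ) :
    List.TFAE [
      UnitaryReal.IsRealElement A,
      ((UnitaryReal.mat A).det = 1 ∨ (UnitaryReal.mat A).det = -1) ∧ (UnitaryReal.mat A).trace = (UnitaryReal.mat A⁻¹).trace,
      ∃ B : UnitaryReal.GU2 σ ℓ, IsConj A B ∧
        (UnitaryReal.FormA B ∨ UnitaryReal.FormB B ∨ UnitaryReal.FormC B ∨
          UnitaryReal.FormD hϖ B)] := by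
  have h2 : IsUnit (2 : 𝔬) := UnitaryReal.isUnit_two_of_odd_ringChar hodd
  have hmax := hϖ.maximalIdeal_eq
  obtain ⟨ε, u, hε⟩ := UnitaryReal.exists_isSkewGenerator h2 hmax σ hσ
  have hnorm : ∀ c : 𝔬, IsUnit c → ∃ z : 𝔒, z * σ z = algebraMap 𝔬 𝔒 c :=
    fun c hc => hε.exists_norm_eq hodd hc
  tfae_have 1 → 2 := UnitaryReal.det_trace_of_isRealElement hℓ h2
  tfae_have 2 → 3 := by
    rintro ⟨hdet | hdet, htr⟩
    · exact UnitaryReal.exists_isConj_form_of_det_eq_one hε hnorm h2 hℓ hϖ hmax hdet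
    · obtain ⟨B, hAB, hB⟩ :=
        UnitaryReal.exists_isConj_weyl_of_det_eq_neg_one hε hnorm h2 hℓ hdet htr
      exact ⟨B, hAB, Or.inr (Or.inr (Or.inl (Or.inl hB)))⟩
  tfae_have 3 → 1 := by
    rintro ⟨B, hAB, hB⟩
    obtain ⟨z, hz⟩ := hnorm (-1) isUnit_one.neg
    exact UnitaryReal.isRealElement_of_isConj hAB
      (UnitaryReal.isRealElement_of_form ⟨z, by rw [hz, map_neg, map_one]⟩ hϖ hB)
  tfae_finish
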